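/- For integers $0\le i\le n$ let ${n \brack i}$ be the unsigned Stirling numbers of the first kind, given by ${n+1 \brack i} = {n \brack i-1} + n{n \brack i}$ and ${0 \brack n}={n \brack 0}=\delta_{n,0}$. For $k\ge 1$ the series $b_k=\sum_{n=1}^\infty \frac{e^{-\pi n^2}}{(\pi n^2)^k}$ converges. Let $$\xi(s) = -\frac{s(1-s)}{2}\,\pi^{-s/2}\,\Gamma\!\left(\tfrac{s}{2}\right)\zeta(s)$$ be the Riemann xi function, with its removable singularities at $s=1,0,-2,-4,\dots$ filled in by limits; it is an entire function. (a) For every $s\in\mathbb{C}$, $$2\xi(s) = 1 - 2\sum_{n=0}^\infty \frac{1}{(n+1)!}\sum_{i=0}^{n} b_{i+1}{n \brack i}\left(s\prod_{j=0}^{i}\Big(\frac{1-s}{2}-j\Big)+(1-s)\prod_{j=0}^{i}\Big(\frac{s}{2}-j\Big)\right),$$ where the series over $n$ converges absolutely. In particular, for $s\notin\{1,0,-2,-4,\dots\}$ its right-hand side equals $-s(1-s)\pi^{-s/2}\Gamma(s/2)\zeta(s)$. (b) For every $s\in\mathbb{C}\setminus\{0,1\}$, $$\pi^{-s/2}\,\Gamma\!\left(\tfrac{s}{2}\right)\zeta(s)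 = 2b_1+\sum_{n=1}^\infty \frac{1}{(n+1)!}\sum_{i=1}^{n} b_{i+1}{n \brack i}\left(\prod_{j=1}^{i}\Big(\frac{1-s}{2}-j\Big)+\prod_{j=1}^{i}\Big(\frac{s}{2}-j\Big)\right)-\Big(\frac{1}{1-s}+\frac1s\Big),$$ where at $s=-2,-4,\dots$ the left-hand side means its limit; the series over $n$ converges absolutely for every $s\in\mathbb{C}$. -/

import Mathlib

open Filter Topology

/-- `π^{-s/2} Γ(s/2) ζ(s)`, literally. It is meaningful where no factor has a pole,
that is for `s ≠ 1` and `s ∉ {0, -2, -4, …}`. -/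
noncomputable def piGammaZeta (s : ℂ) : ℂ :=
  (Real.pi : ℂ) ^ (-s / 2) * Complex.Gamma (s / 2) * riemannZeta s

/-- The points where no factor of `π^{-s/2} Γ(s/2) ζ(s)` has a pole. -/
def IsRegularPoint (s : ℂ) : Prop :=
  s ≠ 1 ∧ ∀ k : ℕ, s ≠ -2 * (k : ℂ)

/-- The Riemann xi function `ξ(s) = -(s(1-s)/2) π^{-s/2} Γ(s/2) ζ(s)`, where the removable
singularities at `1, 0, -2, -4, …` are filled in by taking the limit. -/
noncomputable def riemannXi (s : ℂ) : ℂ :=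
  limUnder (𝓝[≠] s) (fun z : ℂ => -(z * (1 - z) / 2) * piGammaZeta z)

/-- The `n`-th term, counted from `n = 0`, of the series `b_k = ∑_{n ≥ 1} e^{-πn²} / (πn²)^k`. -/
noncomputable def bTerm (k n : ℕ) : ℝ :=
  Real.exp (-(Real.pi * ((n : ℝ) + 1) ^ 2)) / (Real.pi * ((n : ℝ) + 1) ^ 2) ^ k

/-- `b_k = ∑_{n ≥ 1} e^{-πn²} / (πn²)^k`. -/
noncomputable def bConst (k : ℕ) : ℝ :=
  ∑' n : ℕ, bTerm k n

/-- `1/(n+1)! ∑_{i=1}^n b_{i+1} [n,i] (∏_{j=1}^i ((1-s)/2 - j) + ∏_{j=1}^i (s/2 - j))`. -/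
noncomputable def zetaTerm (s : ℂ) (n : ℕ) : ℂ :=
  1 / ((n + 1).factorial : ℂ) * ∑ i ∈ Finset.Icc 1 n,
    (bConst (i + 1) : ℂ) * (Nat.stirlingFirst n i : ℂ) *
      ((∏ j ∈ Finset.Icc 1 i, ((1 - s) / 2 - (j : ℂ))) +
        ∏ j ∈ Finset.Icc 1 i, (s / 2 - (j : ℂ)))

/-- `1/(n+1)! ∑_{i=0}^n b_{i+1} [n,i] (s ∏_{j=0}^i ((1-s)/2 - j) + (1-s) ∏_{j=0}^i (s/2 - j))`. -/
noncomputable def xiTerm (s : ℂ) (n : ℕ) : ℂ :=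
  1 / ((n + 1).factorial : ℂ) * ∑ i ∈ Finset.range (n + 1),
    (bConst (i + 1) : ℂ) * (Nat.stirlingFirst n i : ℂ) *
      (s * (∏ j ∈ Finset.range (i + 1), ((1 - s) / 2 - (j : ℂ))) +
        (1 - s) * ∏ j ∈ Finset.range (i + 1), (s / 2 - (j : ℂ)))

/-! Riemann's Mellin integral, folded at 1 by the theta functional equation, writes
`completedRiemannZeta₀ s` as the sum over a = s/2 and a = (1-s)/2 of ∑_m ∫_1^∞ e^{-cx} x^{a-1} dx
with c = π(m+1)². The substitution u = 1 - e^{-c(x-1)} turns each integral into (e^{-c}/c) ∫_0^1 (1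
- log(1-u)/c)^{a-1} du. The Taylor coefficients of this integrand are Stirling sums in powers of 1/c
(`eqOn_iteratedDeriv_logPow`). Integrating u^n gives 1/(n+1), and summing e^{-c}/c^{i+1} over m
gives b_{i+1}.

The interchanges rest on one estimate, `summable_norm_stirlingCoeff_div`: the sum of |n-th
coefficient|/(n+1) is bounded uniformly in c ≥ π. The integrand grows only logarithmically at the
unit circle, so on |u| = 1 - 2^{-k-1} it is at most a constant times a power of k+4. Bessel and
Cauchy–Schwarz on the block 2^k ≤ n < 2^{k+1} then gain a factor 2^{-k/2}, which makes the sum over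
k converge. Hence the double series over m and n converges absolutely. Both expansions follow from
`hasSum_symmTerm`: multiply by s(1-s)/2, or subtract the polar part. -/

/-! ### Coefficient sums from growth on circles. -/

/-- The Bessel inequality for a polynomial bounded on the unit circle. -/
theorem sum_norm_sq_le_of_norm_sum_le (c : ℕ → ℂ) (N : ℕ) {M : ℝ} (hM : 0 ≤ M)
    (h : ∀ z : ℂ, ‖z‖ = 1 → ‖∑ n ∈ Finset.range N, c n * z ^ n‖ ≤ M) :
    ∑ n ∈ Finset.range N, ‖c n‖ ^ 2 ≤ M ^ 2 := by
  have horth : Orthonormal ℂ (fun n : ℕ => fourierLp (T := (1 : ℝ)) 2 (n : ℤ)) :=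
    orthonormal_fourier.comp (fun n : ℕ => (n : ℤ)) Nat.cast_injective
  let p : C(UnitAddCircle, ℂ) := ∑ n ∈ Finset.range N, c n • fourier (T := (1 : ℝ)) (n : ℤ)
  let q := ContinuousMap.toLp (E := ℂ) 2 (AddCircle.haarAddCircle (T := (1 : ℝ))) ℂ p
  have hq : q = ∑ n ∈ Finset.range N, c n • fourierLp (T := (1 : ℝ)) 2 (n : ℤ) := by
    change ContinuousMap.toLp (E := ℂ) 2 _ ℂ (∑ n ∈ Finset.range N, c n • fourier (n : ℤ)) = _
    rw [map_sum]
    exact Finset.sum_congr rfl fun n _ => map_smul _ _ _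
  have hin : (inner ℂ q q : ℂ) = ∑ n ∈ Finset.range N, (starRingEnd ℂ) (c n) * c n := by
    rw [hq]
    exact horth.inner_sum c c (Finset.range N)
  have hpn : ‖p‖ ≤ M := by
    rw [ContinuousMap.norm_le _ hM]
    intro x
    have hp : p x = ∑ n ∈ Finset.range N, c n * fourier (T := (1 : ℝ)) 1 x ^ n := by
      simp only [p, ContinuousMap.coe_sum, Finset.sum_apply, ContinuousMap.coe_smul, Pi.smul_apply,
        smul_eq_mul, fourier_one]
      refine Finset.sum_congr rfl fun n _ => ?_
      rw [fourier_apply, natCast_zsmul, AddCircle.toCircle_nsmul, Circle.coe_pow]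
    rw [hp]
    exact h _ (by rw [fourier_one]; exact Circle.norm_coe _)
  have hle : ‖q‖ ≤ M := by
    refine (ContinuousLinearMap.le_opNorm _ p).trans ?_
    have h1 : ‖ContinuousMap.toLp (E := ℂ) 2 (AddCircle.haarAddCircle (T := (1 : ℝ))) ℂ‖ ≤ 1 := by
      refine (ContinuousMap.toLp_norm_le _).trans ?_
      simp [MeasureTheory.measureUnivNNReal]
    calc _ ≤ 1 * M := mul_le_mul h1 hpn (norm_nonneg _) zero_le_one
      _ = M := one_mul M
  have hsq : ∑ n ∈ Finset.range N, ‖c n‖ ^ 2 = ‖q‖ ^ 2 := by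
    have := inner_self_eq_norm_sq_to_K (𝕜 := ℂ) q
    rw [hin] at this
    simp only [Complex.conj_mul'] at this
    apply Complex.ofReal_injective
    push_cast
    exact this
  rw [hsq]
  exact pow_le_pow_left₀ (norm_nonneg _) hle 2

/-- The Bessel inequality for an absolutely convergent power series bounded on a circle. -/
theorem sum_norm_sq_mul_pow_le_of_hasSum {c : ℕ → ℂ} {F : ℂ → ℂ} {r M : ℝ} (hr : 0 ≤ r)
    (hM : 0 ≤ M) (hF : ∀ z : ℂ, ‖z‖ = r → HasSum (fun n => c n * z ^ n) (F z))
    (hb : ∀ z : ℂ, ‖z‖ = r → ‖F z‖ ≤ M) (N : ℕ) :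
    ∑ n ∈ Finset.range N, (‖c n‖ * r ^ n) ^ 2 ≤ M ^ 2 := by
  have hsum : Summable (fun n => ‖c n‖ * r ^ n) := by
    have := (hF r (by simp [abs_of_nonneg hr])).summable.norm
    simpa [abs_of_nonneg hr] using this
  set g : ℕ → ℝ := fun n => ‖c n‖ * r ^ n with hg
  have htail : Tendsto (fun K => (M + ∑' n, g (n + K)) ^ 2) atTop (𝓝 ((M + 0) ^ 2)) :=
    ((tendsto_sum_nat_add g).const_add M).pow 2
  rw [add_zero] at htail
  refine ge_of_tendsto htail ?_
  filter_upwards [eventually_ge_atTop N] with K hK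
  have hg0 : ∀ n, 0 ≤ g n := fun n => by positivity
  have htn : 0 ≤ ∑' n, g (n + K) := tsum_nonneg fun n => hg0 _
  -- A partial sum of length K is bounded on the circle by M plus the absolute tail, which vanishes
  -- as K grows.
  have key := sum_norm_sq_le_of_norm_sum_le (fun n => c n * (r : ℂ) ^ n) K
    (M := M + ∑' n, g (n + K)) (by positivity) (by
      intro z hz
      have hz' : ‖(r : ℂ) * z‖ = r := by simp [hz, abs_of_nonneg hr]
      have h1 := hF _ hz'
      have h2 := h1.summable.sum_add_tsum_nat_add K
      rw [h1.tsum_eq] at h2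
      have h3 : ∑ n ∈ Finset.range K, c n * (r : ℂ) ^ n * z ^ n
          = F (r * z) - ∑' n, c (n + K) * ((r : ℂ) * z) ^ (n + K) := by
        rw [← h2, add_sub_cancel_right]
        exact Finset.sum_congr rfl fun n _ => by rw [mul_pow]; ring
      rw [h3]
      refine (norm_sub_le _ _).trans (add_le_add (hb _ hz') ?_)
      have h4 : ∀ n, ‖c (n + K) * ((r : ℂ) * z) ^ (n + K)‖ = g (n + K) := fun n => by
        rw [norm_mul, norm_pow, hz']
      refine (norm_tsum_le_tsum_norm ?_).trans (tsum_congr h4).le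
      simp only [h4]
      exact (summable_nat_add_iff K).2 hsum)
  have hcn : ∀ n, ‖c n * (r : ℂ) ^ n‖ = g n := fun n => by simp [hg, abs_of_nonneg hr]
  simp only [hcn] at key
  exact (Finset.sum_le_sum_of_subset_of_nonneg (Finset.range_mono hK)
    fun n _ _ => by positivity).trans key

/-- Bernoulli gives (1 - 2^{-k-1})^{2^k} ≥ 1/2. Squaring reaches the exponent 2^{k+1}, and squaring
again gives 1/16. -/
theorem one_sixteenth_le_pow (k n : ℕ) (hn : n ≤ 2 ^ (k + 1)) :
    (1 / 16 : ℝ) ≤ ((1 - (2 ^ (k + 1) : ℝ)⁻¹) ^ n) ^ 2 := by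
  have h2 : (1 : ℝ) ≤ 2 ^ k := one_le_pow₀ (by norm_num)
  have hx0 : (0 : ℝ) ≤ 1 - (2 ^ (k + 1) : ℝ)⁻¹ := by
    have : (2 ^ (k + 1) : ℝ)⁻¹ ≤ 1 := inv_le_one_of_one_le₀ (one_le_pow₀ (by norm_num))
    linarith
  have hx1 : 1 - (2 ^ (k + 1) : ℝ)⁻¹ ≤ 1 := by
    have : (0 : ℝ) ≤ (2 ^ (k + 1) : ℝ)⁻¹ := by positivity
    linarith
  have hb : (1 / 2 : ℝ) ≤ (1 - (2 ^ (k + 1) : ℝ)⁻¹) ^ (2 ^ k) := by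
    have := one_add_mul_le_pow (a := -(2 ^ (k + 1) : ℝ)⁻¹) (by linarith) (2 ^ k)
    have e : 1 + ((2 ^ k : ℕ) : ℝ) * -(2 ^ (k + 1) : ℝ)⁻¹ = 1 / 2 := by
      push_cast
      rw [pow_succ]
      field_simp
      norm_num
    rw [e] at this
    simpa [sub_eq_add_neg] using this
  have h1 : ((1 - (2 ^ (k + 1) : ℝ)⁻¹) ^ (2 ^ k)) ^ 2 ≤ (1 - (2 ^ (k + 1) : ℝ)⁻¹) ^ n := by
    rw [← pow_mul, ← pow_succ]
    exact pow_le_pow_of_le_one hx0 hx1 hn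
  have h3 : (1 / 4 : ℝ) ≤ (1 - (2 ^ (k + 1) : ℝ)⁻¹) ^ n := by nlinarith
  nlinarith

/-- A bound for `∑ ‖c n‖ / (n + 1)` over a dyadic block in terms of the maximum of the power series
on a circle. -/
theorem sum_dyadic_block_le {c : ℕ → ℂ} {F : ℂ → ℂ} {M : ℝ} (hM : 0 ≤ M) (k : ℕ)
    (hF : ∀ z : ℂ, ‖z‖ = 1 - (2 ^ (k + 1) : ℝ)⁻¹ → HasSum (fun n => c n * z ^ n) (F z))
    (hb : ∀ z : ℂ, ‖z‖ = 1 - (2 ^ (k + 1) : ℝ)⁻¹ → ‖F z‖ ≤ M) :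
    ∑ n ∈ Finset.Ico (2 ^ k) (2 ^ (k + 1)), ‖c n‖ / (n + 1) ≤ 4 * M * (√2)⁻¹ ^ k := by
  have hr : (0 : ℝ) ≤ 1 - (2 ^ (k + 1) : ℝ)⁻¹ := by
    have : (2 ^ (k + 1) : ℝ)⁻¹ ≤ 1 := inv_le_one_of_one_le₀ (one_le_pow₀ (by norm_num))
    linarith
  have h1 := sum_norm_sq_mul_pow_le_of_hasSum hr hM hF hb (2 ^ (k + 1))
  set s := Finset.Ico (2 ^ k) (2 ^ (k + 1)) with hs
  have h2 : ∑ n ∈ s, ‖c n‖ ^ 2 ≤ 16 * M ^ 2 := by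
    have : ∑ n ∈ s, (1 / 16) * ‖c n‖ ^ 2 ≤ M ^ 2 := by
      refine le_trans ?_ h1
      refine (Finset.sum_le_sum fun n hn => ?_).trans
        (Finset.sum_le_sum_of_subset_of_nonneg (s := s) ?_ fun n _ _ => by positivity)
      · rw [mul_pow, mul_comm]
        exact mul_le_mul_of_nonneg_left
          (one_sixteenth_le_pow k n (Finset.mem_Ico.1 hn).2.le) (by positivity)
      · intro n hn
        exact Finset.mem_range.2 (Finset.mem_Ico.1 hn).2
    rw [← Finset.mul_sum] at this
    linarith
  -- Cauchy–Schwarz over the 2^k indices of the block.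
  have h3 : (∑ n ∈ s, ‖c n‖) ^ 2 ≤ (2 : ℝ) ^ k * (16 * M ^ 2) := by
    refine (sq_sum_le_card_mul_sum_sq).trans ?_
    have : (s.card : ℝ) = 2 ^ k := by
      rw [hs, Nat.card_Ico, pow_succ, mul_two, Nat.add_sub_cancel]
      push_cast
      rfl
    rw [this]
    gcongr
  have h4 : ∑ n ∈ s, ‖c n‖ ≤ √2 ^ k * (4 * M) := by
    refine le_of_sq_le_sq ?_ (by positivity)
    refine h3.trans_eq ?_
    rw [mul_pow, ← pow_mul, mul_comm k 2, pow_mul, Real.sq_sqrt (by norm_num)]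
    ring
  calc ∑ n ∈ s, ‖c n‖ / (n + 1) ≤ ∑ n ∈ s, ‖c n‖ / 2 ^ k := by
        refine Finset.sum_le_sum fun n hn => ?_
        have : ((2 ^ k : ℕ) : ℝ) ≤ n := Nat.cast_le.2 (Finset.mem_Ico.1 hn).1
        push_cast at this
        gcongr
        linarith
    _ = (∑ n ∈ s, ‖c n‖) / 2 ^ k := (Finset.sum_div _ _ _).symm
    _ ≤ √2 ^ k * (4 * M) / 2 ^ k := by gcongr
    _ = 4 * M * (√2)⁻¹ ^ k := by
        have : (2 : ℝ) ^ k = √2 ^ k * √2 ^ k := by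
          rw [← mul_pow, Real.mul_self_sqrt (by norm_num)]
        rw [this, inv_pow]
        field_simp

theorem sum_range_two_pow_le {g B : ℕ → ℝ}
    (hB : ∀ k, ∑ n ∈ Finset.Ico (2 ^ k) (2 ^ (k + 1)), g n ≤ B k) (K : ℕ) :
    ∑ n ∈ Finset.range (2 ^ K), g n ≤ g 0 + ∑ k ∈ Finset.range K, B k := by
  induction K with
  | zero => simp
  | succ K ih =>
    rw [Finset.sum_range_succ, ← Finset.sum_range_add_sum_Ico g
      (Nat.pow_le_pow_right two_pos (Nat.le_succ K))]
    linarith [hB K]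

/-- The sum bounding `∑ ‖c n‖ / (n + 1)` when the power series with coefficients `c n` grows at
most like `C * (k + 4) ^ K` on the circle of radius `1 - 2⁻⁽ᵏ⁺¹⁾`. -/
noncomputable def dyadicBound (C : ℝ) (K : ℕ) : ℝ :=
  ∑' k : ℕ, 4 * (C * ((k : ℝ) + 4) ^ K) * (√2)⁻¹ ^ k

theorem summable_dyadicBound (C : ℝ) (K : ℕ) :
    Summable fun k : ℕ => 4 * (C * ((k : ℝ) + 4) ^ K) * (√2)⁻¹ ^ k := by
  have hs : (√2)⁻¹ < 1 := inv_lt_one_of_one_lt₀ (by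
    rw [Real.lt_sqrt zero_le_one]; norm_num)
  have h := summable_pow_mul_geometric_of_norm_lt_one (R := ℝ) K (r := (√2)⁻¹)
    (by rw [Real.norm_of_nonneg (by positivity)]; exact hs)
  have h' := ((summable_nat_add_iff 4).2 h).mul_left (4 * C * (√2) ^ 4)
  refine h'.congr fun k => ?_
  push_cast
  rw [pow_add]
  have : (√2) ^ 4 * (√2)⁻¹ ^ 4 = 1 := by
    rw [← mul_pow, mul_inv_cancel₀ (by positivity), one_pow]
  linear_combination (4 * C * ((k : ℝ) + 4) ^ K * (√2)⁻¹ ^ k) * this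

theorem summable_norm_div_of_dyadic_bound {c : ℕ → ℂ} {F : ℂ → ℂ} {C : ℝ} (hC : 0 ≤ C) (K : ℕ)
    (hF : ∀ z : ℂ, ‖z‖ < 1 → HasSum (fun n => c n * z ^ n) (F z))
    (hb : ∀ (k : ℕ) (z : ℂ), ‖z‖ = 1 - (2 ^ (k + 1) : ℝ)⁻¹ → ‖F z‖ ≤ C * ((k : ℝ) + 4) ^ K) :
    Summable (fun n : ℕ => ‖c n‖ / (n + 1)) ∧
      ∑' n : ℕ, ‖c n‖ / (n + 1) ≤ ‖c 0‖ + dyadicBound C K := by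
  have hg0 : ∀ n : ℕ, 0 ≤ ‖c n‖ / ((n : ℝ) + 1) := fun n => by positivity
  have hbound : ∀ N, ∑ n ∈ Finset.range N, ‖c n‖ / ((n : ℝ) + 1) ≤ ‖c 0‖ + dyadicBound C K := by
    intro N
    have h1 : ∑ n ∈ Finset.range N, ‖c n‖ / ((n : ℝ) + 1)
        ≤ ∑ n ∈ Finset.range (2 ^ N), ‖c n‖ / ((n : ℝ) + 1) :=
      Finset.sum_le_sum_of_subset_of_nonneg (Finset.range_mono Nat.lt_two_pow_self.le)
        fun n _ _ => hg0 n
    refine h1.trans ((sum_range_two_pow_le (fun k => sum_dyadic_block_le (F := F)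
      (M := C * ((k : ℝ) + 4) ^ K) (by positivity) k (fun z hz => hF z ?_) (hb k)) N).trans ?_)
    · rw [hz]
      have : (0 : ℝ) < (2 ^ (k + 1) : ℝ)⁻¹ := by positivity
      linarith
    · refine add_le_add (by simp) ?_
      exact (summable_dyadicBound C K).sum_le_tsum _ fun k _ => by positivity
  exact ⟨summable_of_sum_range_le hg0 hbound, Real.tsum_le_of_sum_range_le hg0 hbound⟩

/-! ### Taylor expansion of `logPow` in the unit disc. -/

/-- The product `∏_{j=1}^i (a - j)`. -/
noncomputable def prodSub (a : ℂ) (i : ℕ) : ℂ :=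
  ∏ j ∈ Finset.Icc 1 i, (a - (j : ℂ))

theorem prodSub_succ (a : ℂ) (i : ℕ) : prodSub a (i + 1) = prodSub a i * (a - 1 - i) := by
  rw [prodSub, Finset.prod_Icc_succ_top (by omega), prodSub]
  push_cast
  ring

/-- The function `(1 - log (1 - u) / c) ^ (a - 1)`, analytic in the unit disc. -/
noncomputable def logPow (c : ℝ) (a u : ℂ) : ℂ :=
  (1 - Complex.log (1 - u) / c) ^ (a - 1)

/-- The Taylor coefficients of `logPow c a` at `0`. -/
noncomputable def stirlingCoeff (c : ℝ) (a : ℂ) (n : ℕ) : ℂ :=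
  (n.factorial : ℂ)⁻¹ * ∑ i ∈ Finset.range (n + 1),
    (Nat.stirlingFirst n i : ℂ) * (prodSub a i * (c : ℂ)⁻¹ ^ i)

/-- The Stirling recurrence in the shape of the product rule: the first sum comes from
differentiating (1-u)^{-n}, the shifted one from lowering the exponent of 1 - log(1-u)/c. -/
theorem sum_stirlingFirst_succ_mul (Q : ℕ → ℂ) (n : ℕ) :
    ∑ i ∈ Finset.range (n + 2), (Nat.stirlingFirst (n + 1) i : ℂ) * Q i =
      n * ∑ i ∈ Finset.range (n + 1), (Nat.stirlingFirst n i : ℂ) * Q i +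
        ∑ i ∈ Finset.range (n + 1), (Nat.stirlingFirst n i : ℂ) * Q (i + 1) := by
  have h1 : (n : ℂ) * ∑ i ∈ Finset.range (n + 1), (Nat.stirlingFirst n i : ℂ) * Q i =
      ∑ i ∈ Finset.range (n + 1), (n : ℂ) * ((Nat.stirlingFirst n (i + 1) : ℂ) * Q (i + 1)) := by
    have h2 : ∑ i ∈ Finset.range (n + 1), (Nat.stirlingFirst n i : ℂ) * Q i =
        ∑ i ∈ Finset.range (n + 2), (Nat.stirlingFirst n i : ℂ) * Q i := by
      rw [Finset.sum_range_succ _ (n + 1), Nat.stirlingFirst_eq_zero_of_lt (Nat.lt_succ_self n)]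
      simp
    rw [h2, Finset.sum_range_succ', mul_add, Finset.mul_sum]
    -- The i = 0 term has the factor n·[n,0], which is always 0.
    cases n <;> simp
  rw [h1, Finset.sum_range_succ', ← Finset.sum_add_distrib, Nat.stirlingFirst_succ_zero,
    Nat.cast_zero, zero_mul, add_zero]
  refine Finset.sum_congr rfl fun i _ => ?_
  rw [Nat.stirlingFirst_succ_succ]
  push_cast
  ring

theorem one_sub_mem_slitPlane {u : ℂ} (hu : ‖u‖ < 1) : 1 - u ∈ Complex.slitPlane := by
  refine Or.inl ?_
  have := (Complex.re_le_norm u).trans_lt hu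
  simp only [Complex.sub_re, Complex.one_re]
  linarith

/-- Since |1-u| ≤ 2, only log 2 can be lost, and log 2 < (3/4)·3 < (3/4)c. This keeps the base in
the right half-plane, off the branch cut. -/
theorem quarter_le_re_one_sub_log_div {c : ℝ} (hc : Real.pi ≤ c) {u : ℂ} (hu : ‖u‖ < 1) :
    1 / 4 ≤ (1 - Complex.log (1 - u) / c).re := by
  have hpi := Real.pi_gt_three
  have hc0 : 0 < c := by linarith
  rw [Complex.sub_re, Complex.one_re, Complex.div_ofReal_re, Complex.log_re]
  have h0 : 0 < ‖1 - u‖ := norm_pos_iff.2 (Complex.slitPlane_ne_zero (one_sub_mem_slitPlane hu))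
  have h1 : Real.log ‖1 - u‖ ≤ Real.log 2 := by
    refine Real.log_le_log h0 ?_
    have := norm_sub_le (1 : ℂ) u
    rw [norm_one] at this
    linarith
  have h2 : Real.log ‖1 - u‖ / c ≤ 3 / 4 := by
    rw [div_le_iff₀ hc0]
    linarith [Real.log_two_lt_d9]
  linarith

theorem one_sub_log_div_mem_slitPlane {c : ℝ} (hc : Real.pi ≤ c) {u : ℂ} (hu : ‖u‖ < 1) :
    1 - Complex.log (1 - u) / c ∈ Complex.slitPlane :=
  Or.inl (by linarith [quarter_le_re_one_sub_log_div hc hu])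

theorem hasDerivAt_one_sub_log_div (c : ℝ) {u : ℂ} (hu : ‖u‖ < 1) :
    HasDerivAt (fun u : ℂ => 1 - Complex.log (1 - u) / c) ((c : ℂ)⁻¹ * (1 - u)⁻¹) u := by
  refine (((((hasDerivAt_id' u).const_sub 1).clog (one_sub_mem_slitPlane hu)).div_const
    (c : ℂ)).const_sub 1).congr_deriv ?_
  simp only [div_eq_mul_inv]
  ring

theorem hasDerivAt_one_sub_log_div_cpow {c : ℝ} (hc : Real.pi ≤ c) (b : ℂ) {u : ℂ}
    (hu : ‖u‖ < 1) :
    HasDerivAt (fun u : ℂ => (1 - Complex.log (1 - u) / c) ^ b)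
      (b * (1 - Complex.log (1 - u) / c) ^ (b - 1) * ((c : ℂ)⁻¹ * (1 - u)⁻¹)) u :=
  (hasDerivAt_one_sub_log_div c hu).cpow_const (one_sub_log_div_mem_slitPlane hc hu)

theorem differentiableOn_logPow {c : ℝ} (hc : Real.pi ≤ c) (a : ℂ) :
    DifferentiableOn ℂ (logPow c a) (Metric.ball 0 1) := fun u hu =>
  (hasDerivAt_one_sub_log_div_cpow hc (a - 1)
    (by simpa using hu)).differentiableAt.differentiableWithinAt

theorem eqOn_iteratedDeriv_logPow {c : ℝ} (hc : Real.pi ≤ c) (a : ℂ) (n : ℕ) :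
    Set.EqOn (iteratedDeriv n (logPow c a))
      (fun u => (1 - u)⁻¹ ^ n * ∑ i ∈ Finset.range (n + 1), (Nat.stirlingFirst n i : ℂ) *
        (prodSub a i * (c : ℂ)⁻¹ ^ i * (1 - Complex.log (1 - u) / c) ^ (a - 1 - i)))
      (Metric.ball 0 1) := by
  induction n with
  | zero =>
    intro u _
    simp [prodSub, logPow]
  | succ n ih =>
    intro u hu
    rw [iteratedDeriv_succ, ih.deriv Metric.isOpen_ball hu]
    have hu' : ‖u‖ < 1 := by simpa using hu
    have h0 : 1 - u ≠ 0 := Complex.slitPlane_ne_zero (one_sub_mem_slitPlane hu')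
    have hinv : HasDerivAt (fun u : ℂ => (1 - u)⁻¹ ^ n) (n * (1 - u)⁻¹ ^ (n + 1)) u := by
      refine ((((hasDerivAt_id' u).const_sub 1).fun_inv h0).fun_pow n).congr_deriv ?_
      rcases n with _ | n
      · simp
      · simp only [Nat.add_sub_cancel, pow_succ]
        field_simp
    have hsum : HasDerivAt (fun u : ℂ => ∑ i ∈ Finset.range (n + 1),
        (Nat.stirlingFirst n i : ℂ) *
          (prodSub a i * (c : ℂ)⁻¹ ^ i * (1 - Complex.log (1 - u) / c) ^ (a - 1 - i)))
        (∑ i ∈ Finset.range (n + 1), (Nat.stirlingFirst n i : ℂ) * (prodSub a i * (c : ℂ)⁻¹ ^ i *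
          ((a - 1 - i) * (1 - Complex.log (1 - u) / c) ^ (a - 1 - i - 1) *
            ((c : ℂ)⁻¹ * (1 - u)⁻¹)))) u :=
      HasDerivAt.fun_sum fun i _ =>
        ((hasDerivAt_one_sub_log_div_cpow hc (a - 1 - i) hu').const_mul _).const_mul _
    rw [(hinv.fun_mul hsum).deriv]
    beta_reduce
    rw [sum_stirlingFirst_succ_mul, mul_add, ← mul_assoc,
      mul_comm _ (n : ℂ)]
    congr 1
    rw [pow_succ, mul_assoc, Finset.mul_sum (a := (1 - u)⁻¹)]
    congr 1
    refine Finset.sum_congr rfl fun i _ => ?_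
    rw [prodSub_succ, pow_succ]
    push_cast
    rw [show a - 1 - (i : ℂ) - 1 = a - 1 - (i + 1) by ring]
    ring

theorem hasSum_logPow {c : ℝ} (hc : Real.pi ≤ c) (a : ℂ) {u : ℂ} (hu : ‖u‖ < 1) :
    HasSum (fun n => stirlingCoeff c a n * u ^ n) (logPow c a u) := by
  have h := Complex.hasSum_taylorSeries_on_ball (differentiableOn_logPow hc a) (z := u)
    (by simpa using hu)
  have h0 : (0 : ℂ) ∈ Metric.ball (0 : ℂ) 1 := by simp
  refine (funext fun n => ?_ : (fun n => stirlingCoeff c a n * u ^ n) = _) ▸ h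
  rw [eqOn_iteratedDeriv_logPow hc a n h0]
  simp only [sub_zero, smul_eq_mul, stirlingCoeff, Complex.log_one, zero_div, Complex.one_cpow,
    inv_one, one_pow, one_mul, mul_one]
  ring

/-! ### Growth of `logPow`, uniform in c ≥ π. -/

theorem norm_cpow_le_pow_mul_exp {w : ℂ} {B : ℝ} (hB : 1 ≤ B) (hw0 : w ≠ 0) (hw : ‖w‖ ≤ B)
    (hw' : ‖w‖⁻¹ ≤ B) (z : ℂ) :
    ‖w ^ z‖ ≤ Real.exp (Real.pi * ‖z‖) * B ^ ⌈‖z‖⌉₊ := by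
  have hpos : 0 < ‖w‖ := norm_pos_iff.2 hw0
  have h1 : ‖w‖ ^ z.re ≤ B ^ ⌈‖z‖⌉₊ := by
    have h2 : ‖w‖ ^ z.re ≤ B ^ |z.re| := by
      rcases le_total 0 z.re with h | h
      · rw [abs_of_nonneg h]
        exact Real.rpow_le_rpow hpos.le hw h
      · rw [abs_of_nonpos h, ← neg_neg z.re, Real.rpow_neg hpos.le, ← Real.inv_rpow hpos.le, neg_neg]
        exact Real.rpow_le_rpow (inv_nonneg.2 hpos.le) hw' (neg_nonneg.2 h)
    refine h2.trans ?_
    rw [← Real.rpow_natCast]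
    exact Real.rpow_le_rpow_of_exponent_le hB ((Complex.abs_re_le_norm z).trans (Nat.le_ceil _))
  refine (Complex.norm_cpow_le w z).trans ?_
  rw [div_eq_mul_inv, ← Real.exp_neg, mul_comm]
  refine mul_le_mul (Real.exp_le_exp.2 ?_) h1 (Real.rpow_nonneg hpos.le _) (Real.exp_pos _).le
  calc -(w.arg * z.im) ≤ |w.arg * z.im| := neg_le_abs _
    _ = |w.arg| * |z.im| := abs_mul _ _
    _ ≤ Real.pi * ‖z‖ := mul_le_mul (Complex.abs_arg_le_pi w) (Complex.abs_im_le_norm z)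
        (abs_nonneg _) Real.pi_pos.le

/-- On this circle 2^{-k-1} ≤ |1-u| ≤ 2, so the logarithm is O(k). The constant 4 in k+4 also
dominates the inverse of the lower bound 1/4. -/
theorem norm_logPow_le {c : ℝ} (hc : Real.pi ≤ c) (a : ℂ) (k : ℕ) {u : ℂ}
    (hu : ‖u‖ = 1 - (2 ^ (k + 1) : ℝ)⁻¹) :
    ‖logPow c a u‖ ≤ Real.exp (Real.pi * ‖a - 1‖) * ((k : ℝ) + 4) ^ ⌈‖a - 1‖⌉₊ := by
  have hpi := Real.pi_gt_three
  have hc0 : 0 < c := by linarith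
  have hp : (0 : ℝ) < (2 ^ (k + 1) : ℝ)⁻¹ := by positivity
  have hu1 : ‖u‖ < 1 := by linarith
  have hk : (0 : ℝ) ≤ k := Nat.cast_nonneg k
  have hre := (quarter_le_re_one_sub_log_div hc hu1).trans (Complex.re_le_norm _)
  refine norm_cpow_le_pow_mul_exp (by linarith)
    (Complex.slitPlane_ne_zero (one_sub_log_div_mem_slitPlane hc hu1)) ?_ ?_ _
  · have hlow : (2 ^ (k + 1) : ℝ)⁻¹ ≤ ‖1 - u‖ := by
      have := norm_sub_norm_le (1 : ℂ) u
      rw [norm_one] at this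
      linarith
    have hup : ‖1 - u‖ ≤ 2 := by
      have := norm_sub_le (1 : ℂ) u
      rw [norm_one] at this
      linarith
    have hl2 : Real.log 2 ≤ 1 := by linarith [Real.log_two_lt_d9]
    have habs : |Real.log ‖1 - u‖| ≤ k + 1 := by
      rw [abs_le]
      constructor
      · have := Real.log_le_log hp hlow
        rw [Real.log_inv, Real.log_pow] at this
        push_cast at this
        nlinarith
      · have := Real.log_le_log (hp.trans_le hlow) hup
        linarith
    have hlog : ‖Complex.log (1 - u)‖ ≤ (k + 1) + Real.pi := by
      refine (Complex.norm_le_abs_re_add_abs_im _).trans ?_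
      rw [Complex.log_re, Complex.log_im]
      exact add_le_add habs (Complex.abs_arg_le_pi _)
    refine (norm_sub_le _ _).trans ?_
    rw [norm_one, norm_div, Complex.norm_real, Real.norm_of_nonneg hc0.le]
    have : ‖Complex.log (1 - u)‖ / c ≤ k + 3 := by
      rw [div_le_iff₀ hc0]
      nlinarith
    linarith
  · rw [inv_le_comm₀ (by linarith) (by linarith)]
    refine le_trans ?_ hre
    rw [inv_le_comm₀ (by linarith) (by norm_num)]
    norm_num

/-- A bound, uniform in `c ≥ π`, for `∑ ‖stirlingCoeff c a n‖ / (n + 1)`. -/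
noncomputable def stirlingBound (a : ℂ) : ℝ :=
  1 + dyadicBound (Real.exp (Real.pi * ‖a - 1‖)) ⌈‖a - 1‖⌉₊

theorem summable_norm_stirlingCoeff_div {c : ℝ} (hc : Real.pi ≤ c) (a : ℂ) :
    Summable (fun n : ℕ => ‖stirlingCoeff c a n‖ / (n + 1)) ∧
      ∑' n : ℕ, ‖stirlingCoeff c a n‖ / (n + 1) ≤ stirlingBound a := by
  have h := summable_norm_div_of_dyadic_bound (Real.exp_pos _).le _
    (fun z hz => hasSum_logPow hc a hz) (fun k z hz => norm_logPow_le hc a k hz)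
  have h0 : ‖stirlingCoeff c a 0‖ = 1 := by simp [stirlingCoeff, prodSub]
  rwa [h0] at h

/-! ### Factorial series of the incomplete gamma integral. -/

open MeasureTheory in
theorem hasSum_stirlingCoeff_div {c : ℝ} (hc : Real.pi ≤ c) (a : ℂ) :
    HasSum (fun n : ℕ => stirlingCoeff c a n / (n + 1)) (∫ u in Set.Ioo (0 : ℝ) 1, logPow c a u) := by
  have hpow : ∀ n : ℕ, ∫ u in Set.Ioo (0 : ℝ) 1, u ^ n = 1 / ((n : ℝ) + 1) := fun n => by
    rw [← integral_Ioc_eq_integral_Ioo, ← intervalIntegral.integral_of_le zero_le_one, integral_pow]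
    simp
  have hint : ∀ n : ℕ, IntegrableOn (fun u : ℝ => u ^ n) (Set.Ioo 0 1) := fun n =>
    ((continuous_pow n).integrableOn_Icc).mono_set Set.Ioo_subset_Icc_self
  have key := hasSum_integral_of_summable_integral_norm (μ := volume.restrict (Set.Ioo (0 : ℝ) 1))
    (F := fun (n : ℕ) (u : ℝ) => stirlingCoeff c a n * ((u ^ n : ℝ) : ℂ))
    (fun n => (hint n).ofReal.const_mul _) (by
      refine (summable_norm_stirlingCoeff_div hc a).1.congr fun n => ?_
      rw [div_eq_mul_one_div, ← hpow, ← integral_const_mul]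
      refine setIntegral_congr_fun measurableSet_Ioo fun u hu => ?_
      simp [abs_of_pos hu.1])
  have hL : ∀ n : ℕ, ∫ u in Set.Ioo (0 : ℝ) 1, stirlingCoeff c a n * ((u ^ n : ℝ) : ℂ) =
      stirlingCoeff c a n / (n + 1) := fun n => by
    rw [integral_const_mul, integral_complex_ofReal, hpow]
    push_cast
    ring
  simp only [hL] at key
  rwa [setIntegral_congr_fun (g := fun u : ℝ => logPow c a u) measurableSet_Ioo fun u hu => ?_]
    at key
  have := (hasSum_logPow hc a (u := (u : ℂ)) (by simpa [abs_of_pos hu.1] using hu.2)).tsum_eq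
  simpa using this

-- The change of variables u = 1 - e^{-c(x-1)}, under which 1 - log(1-u)/c = x.
open MeasureTheory in
theorem integral_logPow {c : ℝ} (hc : 0 < c) (a : ℂ) :
    ∫ u in Set.Ioo (0 : ℝ) 1, logPow c a u =
      ∫ x in Set.Ioi (1 : ℝ), ((c * Real.exp (-(c * (x - 1))) : ℝ) : ℂ) * (x : ℂ) ^ (a - 1) := by
  have himg : (fun x : ℝ => 1 - Real.exp (-(c * (x - 1)))) '' Set.Ioi 1 = Set.Ioo 0 1 := by
    ext u
    simp only [Set.mem_image, Set.mem_Ioi, Set.mem_Ioo]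
    constructor
    · rintro ⟨x, hx, rfl⟩
      have h1 := Real.exp_pos (-(c * (x - 1)))
      have h2 : Real.exp (-(c * (x - 1))) < 1 := by
        rw [Real.exp_lt_one_iff]
        have := mul_pos hc (sub_pos.2 hx)
        linarith
      constructor <;> linarith
    · rintro ⟨h0, h1⟩
      refine ⟨1 - Real.log (1 - u) / c, ?_, ?_⟩
      · have := div_neg_of_neg_of_pos (Real.log_neg (x := 1 - u) (by linarith) (by linarith)) hc
        linarith
      · rw [show -(c * (1 - Real.log (1 - u) / c - 1)) = Real.log (1 - u) by field_simp; ring,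
          Real.exp_log (by linarith)]
        ring
  have hderiv : ∀ x ∈ Set.Ioi (1 : ℝ), HasDerivWithinAt
      (fun x : ℝ => 1 - Real.exp (-(c * (x - 1)))) (c * Real.exp (-(c * (x - 1)))) (Set.Ioi 1) x := by
    intro x _
    refine HasDerivAt.hasDerivWithinAt ?_
    refine ((((((hasDerivAt_id' x).sub_const 1).const_mul c).fun_neg).exp).const_sub
      1).congr_deriv ?_
    ring
  have hinj : Set.InjOn (fun x : ℝ => 1 - Real.exp (-(c * (x - 1)))) (Set.Ioi 1) := by
    intro x _ y _ h
    have h1 : Real.exp (-(c * (x - 1))) = Real.exp (-(c * (y - 1))) := by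
      simpa using h
    have h2 := mul_left_cancel₀ hc.ne' (neg_injective (Real.exp_injective h1))
    linarith
  rw [← himg, integral_image_eq_integral_abs_deriv_smul measurableSet_Ioi hderiv hinj]
  refine setIntegral_congr_fun measurableSet_Ioi fun x hx => ?_
  have hc' : (c : ℂ) ≠ 0 := Complex.ofReal_ne_zero.2 hc.ne'
  have h1 : (1 : ℂ) - ((1 - Real.exp (-(c * (x - 1))) : ℝ) : ℂ) =
      ((Real.exp (-(c * (x - 1))) : ℝ) : ℂ) := by push_cast; ring
  simp only [logPow]
  rw [abs_of_pos (by positivity), h1, ← Complex.ofReal_log (Real.exp_pos _).le, Real.log_exp,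
    Complex.real_smul]
  congr 2
  push_cast
  field_simp
  ring

open MeasureTheory in
/-- The factorial series expansion of the incomplete gamma integral `∫_1^∞ e^{-cx} x^{a-1} dx`. -/
theorem hasSum_incompleteGamma {c : ℝ} (hc : Real.pi ≤ c) (a : ℂ) :
    HasSum (fun n : ℕ => ((Real.exp (-c) / c : ℝ) : ℂ) * (stirlingCoeff c a n / (n + 1)))
      (∫ x in Set.Ioi (1 : ℝ), ((Real.exp (-(c * x)) : ℝ) : ℂ) * (x : ℂ) ^ (a - 1)) := by
  have hc0 : 0 < c := Real.pi_pos.trans_le hc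
  have h := (hasSum_stirlingCoeff_div hc a).mul_left ((Real.exp (-c) / c : ℝ) : ℂ)
  rw [integral_logPow hc0, ← integral_const_mul] at h
  rwa [setIntegral_congr_fun (g := fun x : ℝ =>
    ((Real.exp (-(c * x)) : ℝ) : ℂ) * (x : ℂ) ^ (a - 1)) measurableSet_Ioi fun x _ => ?_] at h
  beta_reduce
  rw [← mul_assoc, ← Complex.ofReal_mul]
  congr 2
  rw [show -(c * x) = -c + -(c * (x - 1)) by ring, Real.exp_add]
  field_simp

/-! ### The theta function and Riemann's splitting. -/

/-- The number `π (m + 1)²`. -/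
noncomputable def piSq (m : ℕ) : ℝ := Real.pi * ((m : ℝ) + 1) ^ 2

theorem pi_le_piSq (m : ℕ) : Real.pi ≤ piSq m := by
  have : (1 : ℝ) ≤ ((m : ℝ) + 1) ^ 2 := one_le_pow₀ (by linarith [(Nat.cast_nonneg m : (0 : ℝ) ≤ m)])
  exact le_mul_of_one_le_right Real.pi_pos.le this

theorem piSq_pos (m : ℕ) : 0 < piSq m := Real.pi_pos.trans_le (pi_le_piSq m)

theorem bTerm_eq (k m : ℕ) : bTerm k m = Real.exp (-piSq m) / piSq m ^ k := rfl

theorem hasSum_exp_neg_piSq_mul {x : ℝ} (hx : 0 < x) :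
    HasSum (fun m : ℕ => Real.exp (-(piSq m * x))) ((HurwitzZeta.evenKernel 0 x - 1) / 2) := by
  have h := HurwitzZeta.hasSum_int_evenKernel 0 hx
  simp only [add_zero, QuotientAddGroup.mk_zero] at h
  have h1 := (hasSum_nat_add_iff' 1).2 h.nat_add_neg
  -- Pairing n with -n counts n = 0 twice; dropping that pair leaves `evenKernel 0 x - 1`.
  have hv : (HurwitzZeta.evenKernel 0 x + Real.exp (-Real.pi * ((0 : ℤ) : ℝ) ^ 2 * x) -
      ∑ i ∈ Finset.range 1, (Real.exp (-Real.pi * (((i : ℕ) : ℤ) : ℝ) ^ 2 * x) +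
        Real.exp (-Real.pi * ((-((i : ℕ) : ℤ) : ℤ) : ℝ) ^ 2 * x))) / 2 =
      (HurwitzZeta.evenKernel 0 x - 1) / 2 := by
    simp
  rw [← hv]
  refine (funext fun m => ?_ : (fun m : ℕ => Real.exp (-(piSq m * x))) = _) ▸ h1.div_const 2
  rw [piSq]
  push_cast
  rw [neg_sq,
    show -(Real.pi * ((m : ℝ) + 1) ^ 2 * x) = -Real.pi * ((m : ℝ) + 1) ^ 2 * x by ring]
  ring

theorem summable_bTerm (k : ℕ) : Summable (bTerm k) := by
  have h := (hasSum_exp_neg_piSq_mul one_pos).summable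
  simp only [mul_one] at h
  refine Summable.of_nonneg_of_le (fun m => ?_) (fun m => ?_) h
  · have := piSq_pos m
    rw [bTerm_eq]
    positivity
  · rw [bTerm_eq]
    exact div_le_self (Real.exp_pos _).le
      (one_le_pow₀ (by linarith [pi_le_piSq m, Real.pi_gt_three]))

/-- The function `θ(x) - 1 = ∑_{n ≠ 0} e^{-π n² x}`, cut off to `x > 1`. -/
noncomputable def thetaTail : ℝ → ℂ :=
  (Set.Ioi 1).indicator fun x => ((HurwitzZeta.evenKernel 0 x - 1 : ℝ) : ℂ)

theorem mellinConvergent_f_modif (s : ℂ) :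
    MellinConvergent (HurwitzZeta.hurwitzEvenFEPair 0).f_modif s :=
  ((HurwitzZeta.hurwitzEvenFEPair 0).isStrongFEPair_toStrongFEPair.hasMellin s).1

theorem thetaTail_eq_indicator :
    thetaTail = (Set.Ioi 1).indicator (HurwitzZeta.hurwitzEvenFEPair 0).f_modif := by
  funext x
  by_cases hx : x ∈ Set.Ioi (1 : ℝ)
  · have hx' : x ∉ Set.Ioo (0 : ℝ) 1 := fun h => (lt_asymm h.2 hx)
    rw [thetaTail, Set.indicator_of_mem hx, Set.indicator_of_mem hx, WeakFEPair.f_modif,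
      Pi.add_apply, Set.indicator_of_mem hx, Set.indicator_of_notMem hx']
    simp [HurwitzZeta.hurwitzEvenFEPair]
  · rw [thetaTail, Set.indicator_of_notMem hx, Set.indicator_of_notMem hx]

theorem mellinConvergent_thetaTail (s : ℂ) : MellinConvergent thetaTail s := by
  have h := (mellinConvergent_f_modif s).indicator (measurableSet_Ioi (a := (1 : ℝ)))
  refine h.congr_fun (fun x _ => ?_) measurableSet_Ioi
  rw [thetaTail_eq_indicator, Set.indicator_smul_apply]

/-- The part of `f_modif` on (0,1) is the image of the tail under the theta functional equation t ↦
1/t, with ε = 1 and weight 1/2. -/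
theorem f_modif_sub_thetaTail {t : ℝ} (ht : 0 < t) :
    (HurwitzZeta.hurwitzEvenFEPair 0).f_modif t - thetaTail t =
      (t : ℂ) ^ (-(1 / 2) : ℂ) • thetaTail t⁻¹ := by
  set P := HurwitzZeta.hurwitzEvenFEPair 0 with hP
  rcases lt_trichotomy 1 t with h | rfl | h
  · have h1 : t⁻¹ ∉ Set.Ioi (1 : ℝ) := fun h' => lt_asymm (inv_lt_one_of_one_lt₀ h) h'
    rw [thetaTail_eq_indicator, Set.indicator_of_mem (Set.mem_Ioi.2 h), Set.indicator_of_notMem h1,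
      smul_zero, sub_self]
  · simp [WeakFEPair.f_modif, thetaTail]
  · have h1 : 1 < t⁻¹ := (one_lt_inv₀ ht).2 h
    have h2 : t ∉ Set.Ioi (1 : ℝ) := fun h' => lt_asymm h h'
    have hfe := P.hf_modif_FE t⁻¹ (inv_pos.2 ht)
    have hg : P.g_modif = P.f_modif := by
      have := HurwitzZeta.hurwitzEvenFEPair_zero_symm
      calc P.g_modif = P.symm.f_modif := rfl
        _ = P.f_modif := by rw [hP, this]
    rw [hg, one_div, inv_inv] at hfe
    rw [thetaTail_eq_indicator, Set.indicator_of_mem (Set.mem_Ioi.2 h1),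
      Set.indicator_of_notMem h2, sub_zero, hfe]
    congr 1
    have hk : P.k = 1 / 2 := rfl
    have he : P.ε = 1 := rfl
    rw [hk, he, one_mul, Real.inv_rpow ht.le, ← Real.rpow_neg ht.le,
      Complex.ofReal_cpow ht.le]
    push_cast
    rfl

theorem hurwitzEvenFEPair_Λ₀_eq (s : ℂ) :
    (HurwitzZeta.hurwitzEvenFEPair 0).Λ₀ s = mellin thetaTail s + mellin thetaTail (1 / 2 - s) := by
  have h := (hasMellin_sub (mellinConvergent_f_modif s) (mellinConvergent_thetaTail s)).2
  have h1 : mellin (fun t => (HurwitzZeta.hurwitzEvenFEPair 0).f_modif t - thetaTail t) s =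
      mellin thetaTail (1 / 2 - s) := by
    rw [show (1 / 2 - s : ℂ) = -(s + (-(1 / 2))) by ring, ← mellin_comp_inv, ← mellin_cpow_smul]
    refine MeasureTheory.setIntegral_congr_fun measurableSet_Ioi fun t ht => ?_
    simp only [f_modif_sub_thetaTail ht]
  rw [← h1, h, WeakFEPair.Λ₀]
  ring

theorem completedRiemannZeta₀_eq (s : ℂ) :
    completedRiemannZeta₀ s =
      mellin thetaTail (s / 2) / 2 + mellin thetaTail ((1 - s) / 2) / 2 := by
  rw [completedRiemannZeta₀, HurwitzZeta.completedHurwitzZetaEven₀, hurwitzEvenFEPair_Λ₀_eq,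
    show (1 - s) / 2 = 1 / 2 - s / 2 by ring]
  ring

/-! ### The Mellin transform as a sum of incomplete gamma integrals. -/

section MellinThetaTail

open MeasureTheory

theorem mellin_thetaTail (a : ℂ) :
    mellin thetaTail a = ∫ x in Set.Ioi (1 : ℝ),
      ((HurwitzZeta.evenKernel 0 x - 1 : ℝ) : ℂ) * (x : ℂ) ^ (a - 1) := by
  have h : (fun x : ℝ => (x : ℂ) ^ (a - 1) • thetaTail x) = (Set.Ioi 1).indicator fun x : ℝ =>
      ((HurwitzZeta.evenKernel 0 x - 1 : ℝ) : ℂ) * (x : ℂ) ^ (a - 1) := by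
    funext x
    by_cases hx : x ∈ Set.Ioi (1 : ℝ)
    · rw [thetaTail, Set.indicator_of_mem hx, Set.indicator_of_mem hx, smul_eq_mul, mul_comm]
    · rw [thetaTail, Set.indicator_of_notMem hx, Set.indicator_of_notMem hx, smul_zero]
  rw [mellin, h, setIntegral_indicator measurableSet_Ioi,
    Set.inter_eq_self_of_subset_right (Set.Ioi_subset_Ioi zero_le_one)]

theorem norm_exp_mul_cpow (c : ℝ) (a : ℂ) {x : ℝ} (hx : 0 < x) :
    ‖((Real.exp (-(c * x)) : ℝ) : ℂ) * (x : ℂ) ^ (a - 1)‖ =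
      Real.exp (-(c * x)) * x ^ (a.re - 1) := by
  rw [norm_mul, Complex.norm_real, Real.norm_of_nonneg (Real.exp_pos _).le,
    Complex.norm_cpow_eq_rpow_re_of_pos hx]
  simp

theorem integrableOn_exp_mul_cpow {c : ℝ} (hc : 0 < c) (a : ℂ) :
    IntegrableOn (fun x : ℝ => ((Real.exp (-(c * x)) : ℝ) : ℂ) * (x : ℂ) ^ (a - 1))
      (Set.Ioi 1) := by
  have h := (integrableOn_rpow_mul_exp_neg_mul_rpow (p := 1) (s := |a.re|)
    (by linarith [abs_nonneg a.re]) one_pos hc).mono_set (Set.Ioi_subset_Ioi zero_le_one)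
  refine Integrable.mono' h ?_ ?_
  · refine ContinuousOn.aestronglyMeasurable (fun x hx => ?_) measurableSet_Ioi
    have hx0 : (0 : ℝ) < x := zero_lt_one.trans hx
    have h1 : ContinuousAt (fun x : ℝ => (x : ℂ) ^ (a - 1)) x :=
      Complex.continuousAt_ofReal_cpow_const _ _ (Or.inr hx0.ne')
    refine ContinuousAt.continuousWithinAt (ContinuousAt.mul ?_ h1)
    fun_prop
  · refine (ae_restrict_iff' measurableSet_Ioi).2 (ae_of_all _ fun x hx => ?_)
    have hx1 : (1 : ℝ) ≤ x := le_of_lt hx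
    rw [norm_exp_mul_cpow c a (by linarith), mul_comm, Real.rpow_one, neg_mul]
    gcongr
    linarith [le_abs_self a.re]

/-- Taking norms replaces a by its real part, so the factorial series at `a.re` evaluates the
integral. The factor e^{-c}/c makes the bound summable over c = π(m+1)². -/
theorem integral_norm_exp_mul_cpow_le {c : ℝ} (hc : Real.pi ≤ c) (a : ℂ) :
    ∫ x in Set.Ioi (1 : ℝ), ‖((Real.exp (-(c * x)) : ℝ) : ℂ) * (x : ℂ) ^ (a - 1)‖ ≤
      Real.exp (-c) / c * stirlingBound (a.re : ℂ) := by
  have hc0 : 0 < c := Real.pi_pos.trans_le hc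
  have h := hasSum_incompleteGamma hc (a.re : ℂ)
  have hs := (summable_norm_stirlingCoeff_div hc (a.re : ℂ))
  have hw : 0 < Real.exp (-c) / c := by positivity
  have hn : ∀ n : ℕ, ‖((Real.exp (-c) / c : ℝ) : ℂ) * (stirlingCoeff c a.re n / (n + 1))‖ =
      Real.exp (-c) / c * (‖stirlingCoeff c a.re n‖ / (n + 1)) := fun n => by
    rw [norm_mul, Complex.norm_real, Real.norm_of_nonneg hw.le, norm_div]
    norm_cast
  have hI : ((∫ x in Set.Ioi (1 : ℝ), ‖((Real.exp (-(c * x)) : ℝ) : ℂ) * (x : ℂ) ^ (a - 1)‖ : ℝ) : ℂ)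
      = ∫ x in Set.Ioi (1 : ℝ), ((Real.exp (-(c * x)) : ℝ) : ℂ) * (x : ℂ) ^ ((a.re : ℂ) - 1) := by
    rw [← integral_complex_ofReal]
    refine setIntegral_congr_fun measurableSet_Ioi fun x hx => ?_
    have hx0 : (0 : ℝ) < x := zero_lt_one.trans hx
    simp only [norm_exp_mul_cpow c a hx0]
    rw [Complex.ofReal_mul, Complex.ofReal_cpow hx0.le]
    push_cast
    rfl
  have h0 : 0 ≤ ∫ x in Set.Ioi (1 : ℝ), ‖((Real.exp (-(c * x)) : ℝ) : ℂ) * (x : ℂ) ^ (a - 1)‖ :=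
    integral_nonneg fun x => norm_nonneg _
  rw [← Real.norm_of_nonneg h0, ← Complex.norm_real, hI, ← h.tsum_eq]
  refine (norm_tsum_le_tsum_norm ?_).trans ?_
  · simp only [hn]
    exact hs.1.mul_left _
  · simp only [hn]
    rw [tsum_mul_left]
    exact mul_le_mul_of_nonneg_left hs.2 hw.le

theorem hasSum_mellin_thetaTail (a : ℂ) :
    HasSum (fun m : ℕ => ∫ x in Set.Ioi (1 : ℝ),
      ((Real.exp (-(piSq m * x)) : ℝ) : ℂ) * (x : ℂ) ^ (a - 1)) (mellin thetaTail a / 2) := by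
  have key := hasSum_integral_of_summable_integral_norm (μ := volume.restrict (Set.Ioi (1 : ℝ)))
    (F := fun (m : ℕ) (x : ℝ) => ((Real.exp (-(piSq m * x)) : ℝ) : ℂ) * (x : ℂ) ^ (a - 1))
    (fun m => integrableOn_exp_mul_cpow (piSq_pos m) a) (by
      refine Summable.of_nonneg_of_le (fun m => integral_nonneg fun x => norm_nonneg _)
        (fun m => integral_norm_exp_mul_cpow_le (pi_le_piSq m) a) ?_
      refine ((summable_bTerm 1).mul_right (stirlingBound (a.re : ℂ))).congr fun m => ?_
      rw [bTerm_eq, pow_one])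
  have hI : ∫ x in Set.Ioi (1 : ℝ), ∑' m : ℕ, ((Real.exp (-(piSq m * x)) : ℝ) : ℂ) * (x : ℂ) ^ (a - 1)
      = mellin thetaTail a / 2 := by
    rw [mellin_thetaTail, ← integral_div]
    refine setIntegral_congr_fun measurableSet_Ioi fun x hx => ?_
    have h := (Complex.hasSum_ofReal.2 (hasSum_exp_neg_piSq_mul (zero_lt_one.trans hx))).mul_right
      ((x : ℂ) ^ (a - 1))
    refine h.tsum_eq.trans ?_
    push_cast
    ring
  rwa [hI] at key

end MellinThetaTail

/-! ### Interchanging the double series. -/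

/-- The term `1/(n+1)! ∑_{i=0}^n b_{i+1} [n,i] ∏_{j=1}^i (a - j)`. -/
noncomputable def mellinTerm (a : ℂ) (n : ℕ) : ℂ :=
  1 / ((n + 1).factorial : ℂ) * ∑ i ∈ Finset.range (n + 1),
    (bConst (i + 1) : ℂ) * (Nat.stirlingFirst n i : ℂ) * prodSub a i

theorem hasSum_bTerm_mul_stirlingCoeff (a : ℂ) (n : ℕ) :
    HasSum (fun m : ℕ => (bTerm 1 m : ℂ) * (stirlingCoeff (piSq m) a n / (n + 1)))
      (mellinTerm a n) := by
  have h : ∀ i : ℕ, HasSum (fun m : ℕ => (bTerm (i + 1) m : ℂ)) (bConst (i + 1) : ℂ) := fun i =>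
    Complex.hasSum_ofReal.2 (summable_bTerm (i + 1)).hasSum
  have h1 := (hasSum_sum (s := Finset.range (n + 1)) fun i _ =>
    ((h i).mul_right (Nat.stirlingFirst n i : ℂ)).mul_right (prodSub a i)).mul_left
      (1 / ((n + 1).factorial : ℂ))
  refine (funext fun m => ?_ :
    (fun m : ℕ => (bTerm 1 m : ℂ) * (stirlingCoeff (piSq m) a n / (n + 1))) = _) ▸ h1
  have hc : (piSq m : ℂ) ≠ 0 := Complex.ofReal_ne_zero.2 (piSq_pos m).ne'
  have hn : (n.factorial : ℂ) ≠ 0 := Nat.cast_ne_zero.2 n.factorial_ne_zero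
  have hn1 : (n : ℂ) + 1 ≠ 0 := by exact_mod_cast n.succ_ne_zero
  have hS : ∑ i ∈ Finset.range (n + 1),
      (bTerm (i + 1) m : ℂ) * (Nat.stirlingFirst n i : ℂ) * prodSub a i =
      (bTerm 1 m : ℂ) * ∑ i ∈ Finset.range (n + 1),
        (Nat.stirlingFirst n i : ℂ) * (prodSub a i * (piSq m : ℂ)⁻¹ ^ i) := by
    rw [Finset.mul_sum]
    refine Finset.sum_congr rfl fun i _ => ?_
    rw [bTerm_eq, bTerm_eq]
    push_cast
    rw [pow_succ, inv_pow]
    field_simp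
  rw [hS, stirlingCoeff, Nat.factorial_succ]
  push_cast
  field_simp

/-- Summing over n first gives the incomplete gamma integrals, over m first the terms with b_{i+1}.
Absolute convergence follows from `stirlingBound`, which does not depend on m. -/
theorem summable_norm_and_hasSum_mellinTerm (a : ℂ) :
    Summable (fun n => ‖mellinTerm a n‖) ∧ HasSum (mellinTerm a) (mellin thetaTail a / 2) := by
  set f : ℕ × ℕ → ℂ := fun p =>
    (bTerm 1 p.1 : ℂ) * (stirlingCoeff (piSq p.1) a p.2 / (p.2 + 1)) with hf
  have hb0 : ∀ m, 0 ≤ bTerm 1 m := fun m => by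
    have := piSq_pos m
    rw [bTerm_eq]
    positivity
  have hnorm : ∀ m n : ℕ, ‖f (m, n)‖ =
      bTerm 1 m * (‖stirlingCoeff (piSq m) a n‖ / (n + 1)) := fun m n => by
    rw [hf]
    simp only [norm_mul, norm_div, Complex.norm_real, Real.norm_of_nonneg (hb0 m)]
    norm_cast
  have hfib := fun m => summable_norm_stirlingCoeff_div (pi_le_piSq m) a
  have hsum : Summable fun p => ‖f p‖ := by
    rw [summable_prod_of_nonneg fun p => norm_nonneg _]
    constructor
    · intro m
      simp only [hnorm]
      exact (hfib m).1.mul_left _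
    · refine Summable.of_nonneg_of_le (fun m => tsum_nonneg fun n => norm_nonneg _)
        (fun m => ?_) ((summable_bTerm 1).mul_right (stirlingBound a))
      simp only [hnorm]
      rw [tsum_mul_left]
      exact mul_le_mul_of_nonneg_left (hfib m).2 (hb0 m)
  have htot : HasSum f (mellin thetaTail a / 2) := by
    have h1 := hsum.of_norm.hasSum
    have h2 := h1.prod_fiberwise (g := fun m => ∫ x in Set.Ioi (1 : ℝ),
      ((Real.exp (-(piSq m * x)) : ℝ) : ℂ) * (x : ℂ) ^ (a - 1)) fun m => by
        have := hasSum_incompleteGamma (pi_le_piSq m) a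
        simpa only [hf, bTerm_eq, pow_one] using this
    rwa [h2.unique (hasSum_mellin_thetaTail a)] at h1
  have hswap : Summable fun p : ℕ × ℕ => ‖f p.swap‖ := (Equiv.prodComm ℕ ℕ).summable_iff.2 hsum
  constructor
  · refine Summable.of_nonneg_of_le (fun n => norm_nonneg _) (fun n => ?_) hswap.prod
    rw [← (hasSum_bTerm_mul_stirlingCoeff a n).tsum_eq]
    exact norm_tsum_le_tsum_norm (hswap.prod_factor n)
  · exact ((Equiv.prodComm ℕ ℕ).hasSum_iff.2 htot).prod_fiberwise fun n =>
      hasSum_bTerm_mul_stirlingCoeff a n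

/-- The sum of the `mellinTerm`s at `(1 - s) / 2` and `s / 2`. -/
noncomputable def symmTerm (s : ℂ) (n : ℕ) : ℂ :=
  mellinTerm ((1 - s) / 2) n + mellinTerm (s / 2) n

theorem summable_norm_symmTerm (s : ℂ) : Summable fun n => ‖symmTerm s n‖ :=
  Summable.of_nonneg_of_le (fun _ => norm_nonneg _) (fun _ => norm_add_le _ _)
    ((summable_norm_and_hasSum_mellinTerm _).1.add (summable_norm_and_hasSum_mellinTerm _).1)

theorem hasSum_symmTerm (s : ℂ) : HasSum (symmTerm s) (completedRiemannZeta₀ s) := by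
  rw [completedRiemannZeta₀_eq, add_comm]
  exact (summable_norm_and_hasSum_mellinTerm _).2.add (summable_norm_and_hasSum_mellinTerm _).2

theorem symmTerm_zero (s : ℂ) : symmTerm s 0 = 2 * (bConst 1 : ℂ) := by
  simp [symmTerm, mellinTerm, prodSub]
  ring

/-- [n+1,0] = 0, so starting at i = 1 loses nothing. -/
theorem zetaTerm_succ (s : ℂ) (n : ℕ) : zetaTerm s (n + 1) = symmTerm s (n + 1) := by
  rw [zetaTerm, symmTerm, mellinTerm, mellinTerm, ← mul_add, ← Finset.sum_add_distrib,
    Finset.sum_range_succ', Nat.stirlingFirst_succ_zero, Finset.range_eq_Ico,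
    Finset.sum_Ico_add' (fun i => (bConst (i + 1) : ℂ) * (Nat.stirlingFirst (n + 1) i : ℂ) *
      prodSub ((1 - s) / 2) i + (bConst (i + 1) : ℂ) * (Nat.stirlingFirst (n + 1) i : ℂ) *
      prodSub (s / 2) i) 0 (n + 1) 1]
  simp only [Nat.cast_zero, mul_zero, zero_mul, add_zero, zero_add]
  congr 1
  refine Finset.sum_congr rfl fun i _ => ?_
  rw [prodSub, prodSub, mul_add]

theorem prod_range_succ_sub (a : ℂ) (i : ℕ) :
    ∏ j ∈ Finset.range (i + 1), (a - (j : ℂ)) = a * prodSub a i := by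
  induction i with
  | zero => simp [prodSub]
  | succ i ih =>
    rw [Finset.prod_range_succ, ih, prodSub_succ]
    push_cast
    ring

/-- The j = 0 factors (1-s)/2 and s/2 give both products the common factor s(1-s)/2. -/
theorem xiTerm_eq (s : ℂ) (n : ℕ) : xiTerm s n = s * (1 - s) / 2 * symmTerm s n := by
  rw [xiTerm, symmTerm, mellinTerm, mellinTerm, ← mul_add, ← Finset.sum_add_distrib,
    mul_left_comm, Finset.mul_sum (a := s * (1 - s) / 2)]
  congr 1
  refine Finset.sum_congr rfl fun i _ => ?_
  rw [prod_range_succ_sub, prod_range_succ_sub]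
  ring

/-! ### Removable singularities and the two expansions. -/

theorem piGammaZeta_eq {s : ℂ} (hs : IsRegularPoint s) :
    piGammaZeta s = completedRiemannZeta s := by
  have h0 : s ≠ 0 := by simpa using hs.2 0
  have hG : Complex.Gammaℝ s ≠ 0 := by
    rw [Ne, Complex.Gammaℝ_eq_zero_iff]
    rintro ⟨k, hk⟩
    exact hs.2 k (by rw [hk]; ring)
  rw [piGammaZeta, riemannZeta_def_of_ne_zero h0, ← Complex.Gammaℝ_def, mul_div_cancel₀ _ hG]

theorem eventually_isRegularPoint (s : ℂ) : ∀ᶠ z in 𝓝[≠] s, IsRegularPoint z := by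
  have hne : ∀ w : ℂ, ∀ᶠ z in 𝓝[≠] s, z ≠ w := fun w => by
    rcases eq_or_ne w s with rfl | h
    · exact self_mem_nhdsWithin
    · exact nhdsWithin_le_nhds (isOpen_ne.mem_nhds h.symm)
  have hball : ∀ᶠ z in 𝓝[≠] s, z ∈ Metric.ball s 1 :=
    nhdsWithin_le_nhds (Metric.ball_mem_nhds s one_pos)
  -- Only finitely many points -2k can lie in the unit ball about s, so excluding small k suffices.
  have hfin : ∀ᶠ z in 𝓝[≠] s, ∀ k ∈ Finset.range ⌈‖s‖ + 1⌉₊, z ≠ -2 * (k : ℂ) :=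
    (Finset.eventually_all _).2 fun k _ => hne _
  filter_upwards [hne 1, hball, hfin] with z h1 hb hf
  refine ⟨h1, fun k hk => ?_⟩
  by_cases hkm : k ∈ Finset.range ⌈‖s‖ + 1⌉₊
  · exact hf k hkm hk
  · have h2 : ‖s‖ + 1 ≤ k := Nat.ceil_le.1 (not_lt.1 fun h => hkm (Finset.mem_range.2 h))
    have h3 : ‖z‖ < ‖s‖ + 1 := by
      have h4 := norm_add_le s (z - s)
      rw [add_sub_cancel] at h4
      rw [mem_ball_iff_norm] at hb
      linarith
    have h5 : ‖z‖ = 2 * k := by simp [hk]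
    linarith [norm_nonneg s]

theorem neg_mul_completedRiemannZeta {s : ℂ} (h0 : s ≠ 0) (h1 : s ≠ 1) :
    -(s * (1 - s) / 2) * completedRiemannZeta s =
      (1 - s * (1 - s) * completedRiemannZeta₀ s) / 2 := by
  have h1' : 1 - s ≠ 0 := sub_ne_zero.2 h1.symm
  rw [completedRiemannZeta_eq]
  field_simp
  ring

theorem riemannXi_eq (s : ℂ) :
    riemannXi s = (1 - s * (1 - s) * completedRiemannZeta₀ s) / 2 := by
  have hd : Differentiable ℂ fun z : ℂ => (1 - z * (1 - z) * completedRiemannZeta₀ z) / 2 := by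
    have := differentiable_completedZeta₀
    fun_prop
  have ht : Tendsto (fun z : ℂ => (1 - z * (1 - z) * completedRiemannZeta₀ z) / 2) (𝓝[≠] s)
      (𝓝 ((1 - s * (1 - s) * completedRiemannZeta₀ s) / 2)) :=
    (hd.continuous.tendsto s).mono_left nhdsWithin_le_nhds
  refine Tendsto.limUnder_eq (ht.congr' ?_)
  filter_upwards [eventually_isRegularPoint s] with z hz
  rw [piGammaZeta_eq hz, neg_mul_completedRiemannZeta (by simpa using hz.2 0) hz.1]

theorem completedRiemannZeta_eq_tsum_zetaTerm (s : ℂ) :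
    completedRiemannZeta s =
      2 * (bConst 1 : ℂ) + ∑' n : ℕ, zetaTerm s (n + 1) - (1 / (1 - s) + 1 / s) := by
  have h := (hasSum_symmTerm s).summable.tsum_eq_zero_add
  rw [(hasSum_symmTerm s).tsum_eq, symmTerm_zero] at h
  simp only [zetaTerm_succ]
  rw [← h, completedRiemannZeta_eq]
  ring

theorem two_mul_riemannXi_eq (s : ℂ) : 2 * riemannXi s = 1 - 2 * ∑' n : ℕ, xiTerm s n := by
  simp only [xiTerm_eq]
  rw [tsum_mul_left, (hasSum_symmTerm s).tsum_eq, riemannXi_eq]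
  ring

theorem riemannXi_eq_of_isRegularPoint {s : ℂ} (hs : IsRegularPoint s) :
    riemannXi s = -(s * (1 - s) / 2) * piGammaZeta s := by
  rw [riemannXi_eq, piGammaZeta_eq hs, neg_mul_completedRiemannZeta (by simpa using hs.2 0) hs.1]

theorem mainTheorem3 :
    -- the series defining the constants `b_k` converge
    (∀ k : ℕ, 1 ≤ k → Summable (bTerm k)) ∧
    -- `ξ` is entire and has the defining expression wherever that is meaningful
    Differentiable ℂ riemannXi ∧
    (∀ s : ℂ, IsRegularPoint s → riemannXi s = -(s * (1 - s) / 2) * piGammaZeta s) ∧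
    -- the series for `ξ`, at every `s`
    (∀ s : ℂ, Summable (fun n : ℕ => ‖xiTerm s n‖) ∧
      2 * riemannXi s = 1 - 2 * ∑' n : ℕ, xiTerm s n) ∧
    (∀ s : ℂ, IsRegularPoint s →
      -s * (1 - s) * piGammaZeta s = 1 - 2 * ∑' n : ℕ, xiTerm s n) ∧
    -- the series for `π^{-s/2} Γ(s/2) ζ(s)`; the sum runs over `n ≥ 1`
    (∀ s : ℂ, Summable (fun n : ℕ => ‖zetaTerm s (n + 1)‖)) ∧
    (∀ s : ℂ, IsRegularPoint s →
      piGammaZeta s =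
        2 * (bConst 1 : ℂ) + ∑' n : ℕ, zetaTerm s (n + 1) - (1 / (1 - s) + 1 / s)) ∧
    -- at the removable singularities `-2, -4, …` it gives the limit
    (∀ s : ℂ, s ≠ 0 → s ≠ 1 →
      Tendsto piGammaZeta (𝓝[≠] s)
        (𝓝 (2 * (bConst 1 : ℂ) + ∑' n : ℕ, zetaTerm s (n + 1) - (1 / (1 - s) + 1 / s)))) := by
  refine ⟨fun k _ => summable_bTerm k, ?_, fun s => riemannXi_eq_of_isRegularPoint,
    fun s => ⟨?_, two_mul_riemannXi_eq s⟩, fun s hs => ?_, fun s => ?_, fun s hs => ?_,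
    fun s h0 h1 => ?_⟩
  · have := differentiable_completedZeta₀
    rw [funext riemannXi_eq]
    fun_prop
  · simp only [xiTerm_eq, norm_mul]
    exact (summable_norm_symmTerm s).mul_left _
  · rw [← two_mul_riemannXi_eq, riemannXi_eq_of_isRegularPoint hs]
    ring
  · simp only [zetaTerm_succ]
    exact (summable_nat_add_iff 1).2 (summable_norm_symmTerm s)
  · rw [piGammaZeta_eq hs, completedRiemannZeta_eq_tsum_zetaTerm]
  · rw [← completedRiemannZeta_eq_tsum_zetaTerm]
    refine ((differentiableAt_completedZeta h0 h1).continuousAt.tendsto.mono_left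
      nhdsWithin_le_nhds).congr' ?_
    filter_upwards [eventually_isRegularPoint s] with z hz
    exact (piGammaZeta_eq hz).symm
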